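/- **Definitions.** A *de Vries algebra* is a complete Boolean algebra $A$ with a binary relation $\prec$ such that: $1\prec 1$; $a\prec b$ implies $a\le b$; $a\le b\prec c\le d$ implies $a\prec d$; $a\prec b$ and $a\prec c$ imply $a\prec b\wedge c$; $a\prec b$ implies $\neg b\prec\neg a$; $a\prec b$ implies $a\prec c\prec b$ for some $c$; and for each $b\neq 0$ there is $a\ne 0$ with $a\prec b$. A *de Vries morphism* is a map $\rho:A\to B$ of de Vries algebras with $\rho(0)=0$; $\rho(a\wedge b)=\rho(a)\wedge\rho(b)$; $a\prec b$ implies $\neg\rho(\neg a)\prec\rho(b)$; and $\rho(b)=\bigvee\{\rho(a)\mid a\prec b\}$. The composition of de Vries morphisms is $(\rho_2\star\rho_1)(b)=\bigvee\{\rho_2(\rho_1(a))\mid a\prec b\}$. A *de Vries extension* is a one-to-one de Vries morphism $\alpha:A\to B$, where $B$ is an atomic de Vries algebra whose proximity is its order $\le$, such that every element of $B$ is a join of meets of elements of $\alpha[A]$. Two de Vries extensions $\alpha:A\to B$ and $\gamma:C\to B$ are *compatible* if $\alpha[A]=\gamma[C]$. A de Vries extension $\alpha:A\to B$ is *maximal*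 if for every compatible de Vries extension $\gamma:C\to B$ there is a de Vries morphism $\delta:C\to A$ with $\alpha\star\delta=\gamma$. A *compactification* of a completely regular (Hausdorff) space $X$ is an embedding $e:X\to Y$ with dense image into a compact Hausdorff space $Y$. For compactifications $e:X\to Y$ and $e':X\to Y'$ of $X$, write $e\le e'$ if there is a continuous $f:Y'\to Y$ with $f\circ e'=e$; they are *equivalent* if $e\le e'$ and $e'\le e$. Let $\mathsf{Comp}$ be the category whose objects are all compactifications (of arbitrary completely regular spaces) and whose morphisms from $e:X\to Y$ to $e':X'\to Y'$ are the pairs $(f,g)$ of continuous maps $f:X\to X'$, $g:Y\to Y'$ with $g\circ e=e'\circ f$, composed componentwise. For a compact Hausdorff space $Y$, let $\mathcal{RO}(Y)$ be the de Vries algebra of regular open subsets of $Y$, with $U\prec V$ iff $\overline{U}\subseteq V$, and for a set $X$ let $\wp(X)$ be its powerset with proximity $\subseteq$. **Theorem.** Let $X$ be a completely regular (Hausdorff) space, let $e:X\to Y$ be a compactification of $X$, and let $s:X\to\beta X$ be the Stone–Čech compactification of $X$. Then $e^{-1}:\mathcal{RO}(Y)\to\wp(X)$, $U\mapsto e^{-1}(U)$,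 is a de Vries extension, and the following conditions are equivalent: 1. the de Vries extension $e^{-1}:\mathcal{RO}(Y)\to\wp(X)$ is maximal; 2. $e$ is isomorphic to $s$ in $\mathsf{Comp}$; 3. $e$ is equivalent to $s$. -/

import Mathlib

universe u

namespace DeVries

open TopologicalSpace CategoryTheory

/-! ## De Vries algebras and de Vries morphisms -/

/-- A de Vries algebra: a complete Boolean algebra with a de Vries proximity `prox` (written `≺` in
the mathematical literature). -/
class DeVriesAlgebra (A : Type*) extends CompleteBooleanAlgebra A where
  /-- The proximity relation. -/
  prox : A → A → Prop
  prox_top : prox ⊤ ⊤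
  le_of_prox : ∀ {a b : A}, prox a b → a ≤ b
  prox_of_le_of_prox_of_le : ∀ {a b c d : A}, a ≤ b → prox b c → c ≤ d → prox a d
  prox_inf : ∀ {a b c : A}, prox a b → prox a c → prox a (b ⊓ c)
  prox_compl : ∀ {a b : A}, prox a b → prox bᶜ aᶜ
  exists_between : ∀ {a b : A}, prox a b → ∃ c, prox a c ∧ prox c b
  exists_ne_bot_prox : ∀ {b : A}, b ≠ ⊥ → ∃ a, a ≠ ⊥ ∧ prox a b

/-- A de Vries morphism between de Vries algebras. -/
structure IsDeVriesMorphism {A B : Type*} [DeVriesAlgebra A] [DeVriesAlgebra B] (ρ : A → B) :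
    Prop where
  map_bot : ρ ⊥ = ⊥
  map_inf : ∀ a b, ρ (a ⊓ b) = ρ a ⊓ ρ b
  compl_map_compl_prox : ∀ {a b}, DeVriesAlgebra.prox a b → DeVriesAlgebra.prox (ρ aᶜ)ᶜ (ρ b)
  map_eq_sSup : ∀ b, ρ b = sSup {c | ∃ a, DeVriesAlgebra.prox a b ∧ ρ a = c}

/-- The composition `ρ₂ ⋆ ρ₁` of the category of de Vries algebras:
`(ρ₂ ⋆ ρ₁) b = ⋁ {ρ₂ (ρ₁ a) | a ≺ b}`. -/
def star {A₁ A₂ A₃ : Type*} [DeVriesAlgebra A₁] [DeVriesAlgebra A₃]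
    (ρ₂ : A₂ → A₃) (ρ₁ : A₁ → A₂) : A₁ → A₃ :=
  fun b => sSup {c | ∃ a, DeVriesAlgebra.prox a b ∧ ρ₂ (ρ₁ a) = c}

/-- A subset `S` of a complete Boolean algebra is join-meet dense if every element is a join of
meets of subsets of `S`. -/
def JoinMeetDense {B : Type*} [CompleteBooleanAlgebra B] (S : Set B) : Prop :=
  ∀ b : B, ∃ 𝒯 : Set (Set B), (∀ T ∈ 𝒯, T ⊆ S) ∧ b = sSup {m | ∃ T ∈ 𝒯, sInf T = m}

/-- A de Vries extension `α : A → B`: the target `B` is atomic and extremally disconnected (its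
proximity is the order), and `α` is a one-to-one de Vries morphism with join-meet dense image. -/
structure IsDeVriesExtension {A B : Type*} [DeVriesAlgebra A] [DeVriesAlgebra B] (α : A → B) :
    Prop where
  prox_iff_le : ∀ a b : B, DeVriesAlgebra.prox a b ↔ a ≤ b
  isAtomic : IsAtomic B
  isDeVriesMorphism : IsDeVriesMorphism α
  injective : Function.Injective α
  joinMeetDense : JoinMeetDense (Set.range α)

/-- Two de Vries extensions with the same target are compatible if their images agree. -/
def Compatible {A C B : Type*} (α : A → B) (γ : C → B) : Prop :=
  Set.range α = Set.range γ

/-- A de Vries extension `α : A → B` is maximal if for every compatible de Vries extension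
`γ : C → B` there is a de Vries morphism `δ : C → A` with `α ⋆ δ = γ`. As `γ` is injective, every
such `C`, of whatever size, is a copy of an algebra in the universe of `B`, so quantifying over that
universe is no restriction. -/
structure IsMaximalExtension {A : Type*} {B : Type u} [DeVriesAlgebra A] [DeVriesAlgebra B]
    (α : A → B) : Prop where
  isDeVriesExtension : IsDeVriesExtension α
  exists_morphism : ∀ (C : Type u) [DeVriesAlgebra C] (γ : C → B), IsDeVriesExtension γ →
    Compatible α γ → ∃ δ : C → A, IsDeVriesMorphism δ ∧ star α δ = γ

/-! ## The powerset as an atomic extremally disconnected de Vries algebra -/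

/-- The powerset of `X`, with proximity the inclusion. -/
instance instDeVriesAlgebraSet (X : Type*) : DeVriesAlgebra (Set X) where
  prox s t := s ⊆ t
  prox_top := le_rfl
  le_of_prox h := h
  prox_of_le_of_prox_of_le h₁ h₂ h₃ := h₁.trans (h₂.trans h₃)
  prox_inf h₁ h₂ := le_inf h₁ h₂
  prox_compl h := compl_le_compl h
  exists_between {a _} h := ⟨a, le_rfl, h⟩
  exists_ne_bot_prox {b} h := ⟨b, h, le_rfl⟩

/-! ## Regular open sets -/

/-- The regular open subsets of `Y`: the regular elements of the Heyting algebra of open sets. By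
`isRegular_iff` these are the open sets `U` with `interior (closure U) = U`. -/
def RO (Y : Type*) [TopologicalSpace Y] : Type _ := Heyting.Regular (Opens Y)

section RegularOpen

variable {Y : Type*} [TopologicalSpace Y]

/-- The set of points of a regular open set. -/
def RO.toSet (U : RO Y) : Set Y := (Heyting.Regular.val (α := Opens Y) U : Set Y)

theorem opens_coe_compl (U : Opens Y) : ((Uᶜ : Opens Y) : Set Y) = interior (U : Set Y)ᶜ := by
  apply subset_antisymm
  · refine interior_maximal ?_ (Uᶜ).isOpen
    have h : Disjoint (Uᶜ) U := disjoint_compl_left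
    rw [Set.subset_compl_iff_disjoint_right]
    rw [← Opens.coe_disjoint] at h
    exact h
  · have h : (⟨interior (U : Set Y)ᶜ, isOpen_interior⟩ : Opens Y) ≤ Uᶜ := by
      rw [le_compl_iff_disjoint_right, ← Opens.coe_disjoint]
      exact Set.subset_compl_iff_disjoint_right.1 interior_subset
    exact h

theorem opens_coe_compl_compl (U : Opens Y) :
    ((Uᶜᶜ : Opens Y) : Set Y) = interior (closure (U : Set Y)) := by
  simp only [opens_coe_compl, interior_compl, compl_compl]

theorem isRegular_iff (U : Opens Y) :
    Heyting.IsRegular U ↔ interior (closure (U : Set Y)) = (U : Set Y) := by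
  rw [← opens_coe_compl_compl, SetLike.coe_set_eq]
  rfl

/-- The complete Boolean algebra of regular open sets; its Boolean structure is Mathlib's. -/
instance instCompleteBooleanAlgebraRO : CompleteBooleanAlgebra (RO Y) :=
  { (inferInstance : BooleanAlgebra (Heyting.Regular (Opens Y))),
    (Heyting.Regular.gi : GaloisInsertion (Heyting.Regular.toRegular (α := Opens Y))
      _).liftCompleteLattice with }

theorem RO.interior_closure (U : RO Y) : interior (closure U.toSet) = U.toSet :=
  (isRegular_iff _).1 (Heyting.Regular.prop (α := Opens Y) U)

theorem RO.isOpen (U : RO Y) : IsOpen U.toSet :=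
  (Heyting.Regular.val (α := Opens Y) U).isOpen

theorem RO.le_iff {U V : RO Y} : U ≤ V ↔ U.toSet ⊆ V.toSet := Iff.rfl

theorem RO.ext_toSet {U V : RO Y} (h : U.toSet = V.toSet) : U = V :=
  le_antisymm (RO.le_iff.2 h.le) (RO.le_iff.2 h.ge)

/-- The regular open set `interior (closure s)`. -/
def RO.regularize (s : Set Y) : RO Y :=
  ⟨⟨interior (closure s), isOpen_interior⟩, by
    rw [isRegular_iff]
    exact interior_closure_idem⟩

theorem RO.toSet_regularize (s : Set Y) : (RO.regularize s).toSet = interior (closure s) := rfl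

theorem RO.toSet_compl (U : RO Y) : (Uᶜ).toSet = interior (U.toSet)ᶜ :=
  opens_coe_compl _

theorem RO.toSet_inf (U V : RO Y) : (U ⊓ V).toSet = U.toSet ∩ V.toSet := rfl

theorem RO.toSet_bot : (⊥ : RO Y).toSet = ∅ := rfl

theorem RO.toSet_top : (⊤ : RO Y).toSet = Set.univ := rfl

theorem RO.toSet_sSup (S : Set (RO Y)) :
    (sSup S).toSet = interior (closure (⋃ U ∈ S, U.toSet)) := by
  apply subset_antisymm
  · rw [← RO.toSet_regularize, ← RO.le_iff]
    refine sSup_le fun U hU => RO.le_iff.2 ?_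
    exact (interior_maximal (Set.subset_biUnion_of_mem (u := fun U : RO Y => U.toSet) hU)
      U.isOpen).trans (interior_mono subset_closure)
  · rw [← RO.interior_closure (sSup S)]
    refine interior_mono (closure_mono (Set.iUnion₂_subset fun U hU => ?_))
    exact RO.le_iff.1 (le_sSup hU)

theorem RO.toSet_sInf (S : Set (RO Y)) :
    (sInf S).toSet = interior (⋂ U ∈ S, U.toSet) := by
  apply subset_antisymm
  · exact interior_maximal (Set.subset_iInter₂ fun U hU => RO.le_iff.1 (sInf_le hU))
      (RO.isOpen _)
  · have h : RO.regularize (interior (⋂ U ∈ S, U.toSet)) ≤ sInf S := by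
      refine le_sInf fun U hU => RO.le_iff.2 ?_
      rw [RO.toSet_regularize, ← U.interior_closure]
      refine interior_mono (closure_mono ?_)
      exact interior_subset.trans
        (Set.biInter_subset_of_mem (t := fun U : RO Y => U.toSet) hU)
    exact (interior_maximal subset_closure isOpen_interior).trans (RO.le_iff.1 h)

end RegularOpen

/-- For a compact Hausdorff space `Y`, the regular open sets form a de Vries algebra with the
canonical proximity `U ≺ V ↔ closure U ⊆ V`. -/
instance instDeVriesAlgebraRO (Y : Type*) [TopologicalSpace Y] [CompactSpace Y] [T2Space Y] :
    DeVriesAlgebra (RO Y) where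
  prox U V := closure U.toSet ⊆ V.toSet
  prox_top := Set.subset_univ _
  le_of_prox h := RO.le_iff.2 (subset_closure.trans h)
  prox_of_le_of_prox_of_le h₁ h₂ h₃ :=
    (closure_mono (RO.le_iff.1 h₁)).trans (h₂.trans (RO.le_iff.1 h₃))
  prox_inf h₁ h₂ := by
    rw [RO.toSet_inf]
    exact Set.subset_inter h₁ h₂
  prox_compl {a b} h := by
    rw [RO.toSet_compl, RO.toSet_compl, interior_compl, interior_compl]
    refine (closure_mono (Set.compl_subset_compl.2 subset_closure)).trans ?_
    rw [b.isOpen.isClosed_compl.closure_eq]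
    exact Set.compl_subset_compl.2 h
  exists_between {a b} h := by
    obtain ⟨W, hW, haW, hWb⟩ := normal_exists_closure_subset isClosed_closure b.isOpen h
    refine ⟨RO.regularize W, haW.trans (hW.subset_interior_closure), ?_⟩
    rw [RO.toSet_regularize]
    exact (closure_minimal interior_subset isClosed_closure).trans hWb
  exists_ne_bot_prox {b} h := by
    have hne : b.toSet.Nonempty := by
      rw [Set.nonempty_iff_ne_empty]
      exact fun h0 => h (RO.ext_toSet h0)
    obtain ⟨y, hy⟩ := hne
    obtain ⟨W, hW, hyW, hWb⟩ := normal_exists_closure_subset isClosed_singleton b.isOpen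
      (Set.singleton_subset_iff.2 hy)
    refine ⟨RO.regularize W, fun h0 => ?_, ?_⟩
    · have : y ∈ (RO.regularize W).toSet := hW.subset_interior_closure (hyW rfl)
      rw [h0] at this
      exact this
    · rw [RO.toSet_regularize]
      exact (closure_minimal interior_subset isClosed_closure).trans hWb

/-- The map `e⁻¹ : RO(Y) → ℘(X)` attached to `e : X → Y`. -/
def roPreimage {X Y : Type*} [TopologicalSpace Y] (e : X → Y) : RO Y → Set X :=
  fun U => e ⁻¹' U.toSet

/-! ## Compactifications -/

/-- The order on compactifications of `X`: `e ≤ e'` if there is a continuous `f : Y' → Y` with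
`f ∘ e' = e`. -/
def CompactificationLE {X Y Y' : Type*} [TopologicalSpace Y] [TopologicalSpace Y']
    (e : X → Y) (e' : X → Y') : Prop :=
  ∃ f : Y' → Y, Continuous f ∧ f ∘ e' = e

/-- Equivalence of compactifications of `X`: `e ≤ e'` and `e' ≤ e`. -/
def CompactificationEquiv {X Y Y' : Type*} [TopologicalSpace Y] [TopologicalSpace Y']
    (e : X → Y) (e' : X → Y') : Prop :=
  CompactificationLE e e' ∧ CompactificationLE e' e

/-- An object of the category of compactifications: a dense embedding `e` of a completely regular
(Hausdorff) space into a compact Hausdorff space. -/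
structure Compactification where
  /-- The base space. -/
  base : Type u
  [topBase : TopologicalSpace base]
  [t35Base : T35Space base]
  /-- The compact Hausdorff target. -/
  target : Type u
  [topTarget : TopologicalSpace target]
  [compactTarget : CompactSpace target]
  [t2Target : T2Space target]
  /-- The embedding. -/
  e : base → target
  isDenseEmbedding : IsDenseEmbedding e

namespace Compactification

attribute [instance] topBase t35Base topTarget compactTarget t2Target

/-- A morphism of compactifications: a commutative square of continuous maps. -/
@[ext]
structure Hom (K L : Compactification.{u}) where
  /-- The map of base spaces. -/
  f : C(K.base, L.base)
  /-- The map of targets. -/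
  g : C(K.target, L.target)
  comm : ∀ x, g (K.e x) = L.e (f x)

/-- The category of compactifications, where the base space may vary. -/
instance instCategory : Category Compactification.{u} where
  Hom := Hom
  id K := ⟨ContinuousMap.id _, ContinuousMap.id _, fun _ => rfl⟩
  comp φ ψ := ⟨ψ.f.comp φ.f, ψ.g.comp φ.g, fun x => by
    simp only [ContinuousMap.comp_apply, φ.comm, ψ.comm]⟩

/-- The Stone–Čech compactification of a completely regular (Hausdorff) space. -/
def stoneCech (X : Type u) [TopologicalSpace X] [T35Space X] : Compactification.{u} where
  base := X
  target := StoneCech X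
  e := stoneCechUnit
  isDenseEmbedding := isDenseEmbedding_stoneCechUnit

end Compactification

end DeVries

namespace DeVries

open TopologicalSpace CategoryTheory Topology Filter

/-! ## Generalities on de Vries algebras -/

/-! The traces on `X` of the regular open sets of any compactification are exactly the regular open
sets of `X` (`range_roPreimage`). Hence all compactifications of `X` give compatible extensions,
which carry the same Boolean algebra and differ only in the proximity. If `e` lies above `βX`, the
proximity of `RO Y` contains that of every compatible `γ`: interpolating `a ≺ b` yields a Urysohn
function on `X` separating `γ a` from the complement of `γ b`, this function extends to `Y`, and the
extension witnesses `≺` there (`prox_of_separating`). The order isomorphism of the domains is then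
the required morphism. Conversely, maximality tested against `βX` gives a morphism `δ : RO (βX) → RO
Y`, and `δ` forces `stoneCechUnit` to converge along the trace on `X` of each neighbourhood filter
of `Y`, hence to extend to `Y` (`compactificationLE_of_star_eq`). -/

theorem prox_mono {A : Type*} [DeVriesAlgebra A] {a b c d : A} (h₁ : a ≤ b)
    (h₂ : DeVriesAlgebra.prox b c) (h₃ : c ≤ d) : DeVriesAlgebra.prox a d :=
  DeVriesAlgebra.prox_of_le_of_prox_of_le h₁ h₂ h₃

/-- A nonzero part of `b` missed by the join would have a nonzero element well inside it, and the
join already counts that element. -/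
theorem eq_sSup_prox {A : Type*} [DeVriesAlgebra A] (b : A) :
    b = sSup {a | DeVriesAlgebra.prox a b} := by
  refine le_antisymm ?_ (sSup_le fun a ha => DeVriesAlgebra.le_of_prox ha)
  by_contra h
  have hne : b ⊓ (sSup {a | DeVriesAlgebra.prox a b})ᶜ ≠ ⊥ := fun h0 =>
    h (by rwa [← sdiff_eq, sdiff_eq_bot_iff] at h0)
  obtain ⟨a, ha, hab⟩ := DeVriesAlgebra.exists_ne_bot_prox hne
  refine ha (le_bot_iff.1 ?_)
  rw [← inf_compl_eq_bot (a := sSup {a | DeVriesAlgebra.prox a b})]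
  exact le_inf (le_sSup (prox_mono le_rfl hab inf_le_left))
    ((DeVriesAlgebra.le_of_prox hab).trans inf_le_right)

theorem IsDeVriesMorphism.monotone {A B : Type*} [DeVriesAlgebra A] [DeVriesAlgebra B]
    {ρ : A → B} (h : IsDeVriesMorphism ρ) : Monotone ρ := fun a b hab => by
  rw [← inf_eq_left, ← h.map_inf, inf_eq_left.2 hab]

theorem IsDeVriesMorphism.le_iff_of_injective {A B : Type*} [DeVriesAlgebra A]
    [DeVriesAlgebra B] {ρ : A → B} (h : IsDeVriesMorphism ρ) (hi : Function.Injective ρ)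
    {a b : A} : ρ a ≤ ρ b ↔ a ≤ b := by
  rw [← inf_eq_left, ← h.map_inf, hi.eq_iff, inf_eq_left]

/-- The order isomorphism between the domains of two compatible extensions. -/
theorem Compatible.exists_orderIso {A C B : Type*} [DeVriesAlgebra A] [DeVriesAlgebra C]
    [DeVriesAlgebra B] {α : A → B} {γ : C → B} (hα : IsDeVriesExtension α)
    (hγ : IsDeVriesExtension γ) (h : Compatible α γ) : ∃ θ : C ≃o A, ∀ c, α (θ c) = γ c := by
  have h₁ : ∀ c, ∃ a, α a = γ c := fun c => by
    have : γ c ∈ Set.range α := by rw [h]; exact ⟨c, rfl⟩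
    exact this
  choose θ hθ using h₁
  have hbij : Function.Bijective θ := by
    refine ⟨fun c d hcd => hγ.injective (by rw [← hθ, ← hθ, hcd]), fun a => ?_⟩
    have : α a ∈ Set.range γ := by rw [← h]; exact ⟨a, rfl⟩
    obtain ⟨c, hc⟩ := this
    exact ⟨c, hα.injective (by rw [hθ, hc])⟩
  refine ⟨⟨Equiv.ofBijective θ hbij, fun {c d} => ?_⟩, hθ⟩
  rw [← hγ.isDeVriesMorphism.le_iff_of_injective hγ.injective,
    ← hα.isDeVriesMorphism.le_iff_of_injective hα.injective, ← hθ, ← hθ]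
  rfl

/-- A Boolean isomorphism preserving proximity is a de Vries morphism. -/
theorem OrderIso.isDeVriesMorphism {A C : Type*} [DeVriesAlgebra A] [DeVriesAlgebra C]
    (θ : C ≃o A)
    (h : ∀ {c d}, DeVriesAlgebra.prox c d → DeVriesAlgebra.prox (θ c) (θ d)) :
    IsDeVriesMorphism θ where
  map_bot := θ.map_bot
  map_inf := θ.map_inf
  compl_map_compl_prox hcd := by
    rw [map_compl θ, compl_compl]
    exact h hcd
  map_eq_sSup b := by
    -- Only the join in the domain is needed, so `θ` need not reflect `≺`.
    conv_lhs => rw [eq_sSup_prox b]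
    rw [θ.map_sSup, ← sSup_image]
    rfl

/-! ## Regular open sets and dense embeddings -/

/-- This turns the third morphism axiom into a dichotomy for points in
`compactificationLE_of_star_eq`. -/
theorem RO.closure_compl_eq {Y : Type*} [TopologicalSpace Y] (U : RO Y) :
    closure (Uᶜ).toSet = U.toSetᶜ := by
  rw [RO.toSet_compl, interior_compl, closure_compl, U.interior_closure]

/-- In a compact Hausdorff space every neighbourhood contains a well-inside regular open one. -/
theorem RO.exists_mem_closure_subset {Y : Type*} [TopologicalSpace Y] [CompactSpace Y]
    [T2Space Y] {y : Y} {V : Set Y} (hV : IsOpen V) (hy : y ∈ V) :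
    ∃ U : RO Y, y ∈ U.toSet ∧ closure U.toSet ⊆ V := by
  obtain ⟨W, hW, hyW, hWV⟩ := normal_exists_closure_subset isClosed_singleton hV
    (Set.singleton_subset_iff.2 hy)
  refine ⟨RO.regularize W, hW.subset_interior_closure (hyW rfl), ?_⟩
  rw [RO.toSet_regularize]
  exact (closure_minimal interior_subset isClosed_closure).trans hWV

section Preimage

variable {X Y : Type*} [TopologicalSpace Y] {e : X → Y}

/-- An open set is contained in every regular open set containing its trace on a dense set. -/
theorem subset_of_preimage_subset (he : DenseRange e) {V : Set Y} (hV : IsOpen V) (U : RO Y)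
    (h : e ⁻¹' V ⊆ e ⁻¹' U.toSet) : V ⊆ U.toSet := by
  rw [← U.interior_closure]
  refine interior_maximal ?_ hV
  refine (he.open_subset_closure_inter hV).trans (closure_mono ?_)
  rintro _ ⟨hy, x, rfl⟩
  exact h hy

theorem roPreimage_injective (he : DenseRange e) : Function.Injective (roPreimage e) :=
  fun U V h => RO.ext_toSet <|
    (subset_of_preimage_subset he U.isOpen V (Eq.subset h)).antisymm
      (subset_of_preimage_subset he V.isOpen U (Eq.subset h.symm))

/-- The traces of the regular open sets on a dense subspace are its regular open sets. -/
theorem range_roPreimage [TopologicalSpace X] (he : IsDenseEmbedding e) :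
    Set.range (roPreimage e) = {S | interior (closure S) = S} := by
  have hcl : ∀ S : Set X, closure S = e ⁻¹' closure (e '' S) :=
    fun S => he.isInducing.closure_eq_preimage_closure_image S
  ext S
  constructor
  · rintro ⟨U, rfl⟩
    have hcont := he.isInducing.continuous
    refine subset_antisymm ?_ ((U.isOpen.preimage hcont).subset_interior_closure)
    -- Lift to an open `V` of `Y`: by density `V` lies in the closure of its own trace, hence in
    -- `closure U`, and regularity of `U` gives `V ⊆ U`.
    obtain ⟨V, hV, hVS⟩ := he.isInducing.isOpen_iff.1
      (isOpen_interior (s := closure (roPreimage e U)))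
    rw [← hVS]
    refine Set.preimage_mono (?_ : V ⊆ U.toSet)
    rw [← U.interior_closure]
    refine interior_maximal ?_ hV
    refine (he.dense.open_subset_closure_inter hV).trans
      (closure_minimal ?_ isClosed_closure)
    rintro _ ⟨hy, x, rfl⟩
    have hx : x ∈ interior (closure (roPreimage e U)) := by rw [← hVS]; exact hy
    have hx' := interior_subset hx
    rw [hcl] at hx'
    exact closure_mono (Set.image_preimage_subset e _) hx'
  · intro hS
    have hSo : IsOpen S := by rw [← hS.out]; exact isOpen_interior
    refine ⟨RO.regularize (e '' S), subset_antisymm ?_ ?_⟩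
    · conv_rhs => rw [← hS.out]
      refine interior_maximal ?_ (isOpen_interior.preimage he.isInducing.continuous)
      rw [hcl]
      exact Set.preimage_mono interior_subset
    · obtain ⟨V, hV, hVS⟩ := he.isInducing.isOpen_iff.1 hSo
      conv_lhs => rw [← hVS]
      refine Set.preimage_mono (interior_maximal ?_ hV)
      refine (he.dense.open_subset_closure_inter hV).trans (closure_mono ?_)
      rintro _ ⟨hy, x, rfl⟩
      exact ⟨x, by rw [← hVS]; exact hy, rfl⟩

variable [CompactSpace Y] [T2Space Y]

variable (e) in
theorem roPreimage_isDeVriesMorphism : IsDeVriesMorphism (roPreimage e) where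
  map_bot := rfl
  map_inf _ _ := rfl
  compl_map_compl_prox {U V} h := by
    change (e ⁻¹' (Uᶜ).toSet)ᶜ ⊆ e ⁻¹' V.toSet
    rw [← Set.preimage_compl, RO.toSet_compl, interior_compl, compl_compl]
    exact Set.preimage_mono h
  map_eq_sSup V := by
    refine subset_antisymm (fun x hx => ?_) ?_
    · obtain ⟨U, hxU, hUV⟩ := RO.exists_mem_closure_subset V.isOpen (y := e x) hx
      exact Set.mem_sUnion.2 ⟨roPreimage e U, ⟨U, hUV, rfl⟩, hxU⟩
    · refine Set.sUnion_subset ?_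
      rintro _ ⟨U, hUV, rfl⟩
      exact Set.preimage_mono (subset_closure.trans hUV)

theorem roPreimage_joinMeetDense (he : Function.Injective e) :
    JoinMeetDense (Set.range (roPreimage e)) := by
  intro S
  -- `S` is the join of its singletons, and `{x}` is the meet of the traces of all regular open
  -- neighbourhoods of `e x`.
  refine ⟨{T | ∃ x ∈ S, T = {P | ∃ U : RO Y, e x ∈ U.toSet ∧ roPreimage e U = P}}, ?_, ?_⟩
  · rintro _ ⟨x, -, rfl⟩ _ ⟨U, -, rfl⟩
    exact ⟨U, rfl⟩
  · refine subset_antisymm (fun x hx => ?_) ?_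
    · refine Set.mem_sUnion.2 ⟨_, ⟨_, ⟨x, hx, rfl⟩, rfl⟩, Set.mem_sInter.2 ?_⟩
      rintro _ ⟨U, hU, rfl⟩
      exact hU
    · refine Set.sUnion_subset ?_
      rintro _ ⟨_, ⟨x, hx, rfl⟩, rfl⟩ z hz
      by_contra hzS
      have hne : e x ∈ ({e z} : Set Y)ᶜ := fun h => hzS (he h ▸ hx)
      obtain ⟨U, hxU, hU⟩ := RO.exists_mem_closure_subset isOpen_compl_singleton hne
      exact hU (subset_closure (Set.mem_sInter.1 hz _ ⟨U, hxU, rfl⟩)) rfl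

theorem roPreimage_isDeVriesExtension [TopologicalSpace X] (he : IsDenseEmbedding e) :
    IsDeVriesExtension (roPreimage e) where
  prox_iff_le _ _ := Iff.rfl
  isAtomic := inferInstanceAs (IsAtomic (Set X))
  isDeVriesMorphism := roPreimage_isDeVriesMorphism e
  injective := roPreimage_injective he.dense
  joinMeetDense := roPreimage_joinMeetDense he.injective

end Preimage

/-! ## Maximality of the Stone–Čech extension -/

/-- For a de Vries morphism to a powerset with open values, if `a ≺ b`, then the value at `a` is
completely separated from the complement of the value at `b`. -/
theorem IsDeVriesMorphism.exists_continuous_separating {X C : Type*} [TopologicalSpace X]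
    [DeVriesAlgebra C] {γ : C → Set X} (hγ : IsDeVriesMorphism γ) (ho : ∀ c, IsOpen (γ c))
    {a b : C} (hab : DeVriesAlgebra.prox a b) :
    ∃ f : X → ℝ, Continuous f ∧ Set.EqOn f 0 (γ a) ∧ Set.EqOn f 1 (γ b)ᶜ ∧
      ∀ x, f x ∈ Set.Icc (0 : ℝ) 1 := by
  -- `γ c` and `γ cᶜ` are disjoint open sets.
  have hcl : ∀ c, closure (γ c) ⊆ (γ cᶜ)ᶜ := fun c =>
    closure_minimal (fun x hx hx' => by
      have h : x ∈ γ (c ⊓ cᶜ) := by rw [hγ.map_inf]; exact ⟨hx, hx'⟩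
      rw [inf_compl_eq_bot, hγ.map_bot] at h
      exact h) (ho _).isClosed_compl
  have hprox : ∀ {c d}, DeVriesAlgebra.prox c d → (γ cᶜ)ᶜ ⊆ γ d :=
    fun h => hγ.compl_map_compl_prox h
  -- `X` need not be normal; Urysohn's construction runs on pairs carrying a witness `c ≺ d`, which
  -- the interpolation axiom splits. The bound is `(γ cᶜ)ᶜ` rather than `γ c` because it must
  -- contain `closure (γ c)`.
  let P : Set X → Set X → Prop := fun s u =>
    ∃ c d, DeVriesAlgebra.prox c d ∧ s ⊆ (γ cᶜ)ᶜ ∧ γ d ⊆ u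
  let K : Urysohns.CU P :=
    { C := closure (γ a)
      U := γ b
      P_C_U := ⟨a, b, hab, hcl a, le_rfl⟩
      closed_C := isClosed_closure
      open_U := ho b
      subset := (hcl a).trans (hprox hab)
      hP := by
        rintro s u - ⟨c, d, hcd, hs, hu⟩ - -
        obtain ⟨m, hcm, hmd⟩ := DeVriesAlgebra.exists_between hcd
        exact ⟨γ m, ho m, hs.trans (hprox hcm), ((hcl m).trans (hprox hmd)).trans hu,
          ⟨c, m, hcm, hs, le_rfl⟩, ⟨m, d, hmd, hcl m, hu⟩⟩ }
  exact ⟨K.lim, K.continuous_lim, fun x hx => K.lim_of_mem_C x (subset_closure hx),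
    fun x hx => K.lim_of_notMem_U x hx, K.lim_mem_Icc⟩

/-- Functions into a compact Hausdorff space extend along a compactification above `βX`. -/
theorem exists_continuous_extension {X Y K : Type*} [TopologicalSpace X] [TopologicalSpace Y]
    [TopologicalSpace K] [CompactSpace K] [T2Space K] {e : X → Y}
    (h : CompactificationLE (stoneCechUnit : X → StoneCech X) e) {f : X → K}
    (hf : Continuous f) : ∃ F : Y → K, Continuous F ∧ ∀ x, F (e x) = f x := by
  obtain ⟨g, hg, hge⟩ := h
  refine ⟨stoneCechExtend hf ∘ g, (continuous_stoneCechExtend hf).comp hg, fun x => ?_⟩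
  rw [Function.comp_apply, ← Function.comp_apply (f := g) (g := e), hge,
    stoneCechExtend_stoneCechUnit]

/-- The extension `F` of `f` to `Y` vanishes on `closure U`, while the open set `{F < 1}` has its
trace inside that of `V`, hence lies in `V` by regularity. -/
theorem prox_of_separating {X Y : Type*} [TopologicalSpace X] [TopologicalSpace Y]
    [CompactSpace Y] [T2Space Y] {e : X → Y} (he : DenseRange e)
    (h : CompactificationLE (stoneCechUnit : X → StoneCech X) e) {U V : RO Y} {f : X → ℝ}
    (hf : Continuous f) (h0 : Set.EqOn f 0 (roPreimage e U))
    (h1 : Set.EqOn f 1 (roPreimage e V)ᶜ) (hI : ∀ x, f x ∈ Set.Icc (0 : ℝ) 1) :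
    DeVriesAlgebra.prox U V := by
  obtain ⟨F, hF, hFe⟩ := exists_continuous_extension h
    (K := Set.Icc (0 : ℝ) 1) (f := fun x => ⟨f x, hI x⟩) (hf.subtype_mk hI)
  have hFc : Continuous fun y => (F y : ℝ) := continuous_subtype_val.comp hF
  have hU : closure U.toSet ⊆ {y | (F y : ℝ) = 0} := by
    refine (closure_mono (he.open_subset_closure_inter U.isOpen)).trans ?_
    rw [closure_closure]
    refine closure_minimal ?_ (isClosed_eq hFc continuous_const)
    rintro _ ⟨hy, x, rfl⟩
    rw [Set.mem_ofPred_eq, hFe]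
    exact h0 hy
  refine hU.trans (Set.Subset.trans (fun y hy => ?_)
    (subset_of_preimage_subset he (V := {y | (F y : ℝ) < 1})
      (isOpen_lt hFc continuous_const) V fun x hx => ?_))
  · rw [Set.mem_ofPred_eq, hy.out]
    exact zero_lt_one
  · by_contra hxV
    rw [Set.mem_preimage, Set.mem_ofPred_eq, hFe] at hx
    exact hx.ne (h1 hxV)

theorem isMaximalExtension_of_stoneCech_le {X Y : Type u} [TopologicalSpace X]
    [TopologicalSpace Y] [CompactSpace Y] [T2Space Y] {e : X → Y} (he : IsDenseEmbedding e)
    (h : CompactificationLE (stoneCechUnit : X → StoneCech X) e) :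
    IsMaximalExtension (roPreimage e) where
  isDeVriesExtension := roPreimage_isDeVriesExtension he
  exists_morphism C _ γ hγ hc := by
    obtain ⟨θ, hθ⟩ := hc.exists_orderIso (roPreimage_isDeVriesExtension he) hγ
    have ho : ∀ c, IsOpen (γ c) := fun c => by
      rw [← hθ]
      exact (θ c).isOpen.preimage he.isInducing.continuous
    refine ⟨θ, OrderIso.isDeVriesMorphism θ fun {a b} hab => ?_, funext fun b => ?_⟩
    · obtain ⟨f, hf, h0, h1, hI⟩ := hγ.isDeVriesMorphism.exists_continuous_separating ho hab
      rw [← hθ] at h0 h1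
      exact prox_of_separating he.dense h hf h0 h1 hI
    · rw [hγ.isDeVriesMorphism.map_eq_sSup b]
      simp only [star, hθ]

/-! ## De Vries morphisms induce continuous extensions -/

theorem star_roPreimage_le {A X Y : Type*} [DeVriesAlgebra A] [TopologicalSpace Y]
    {e : X → Y} {δ : A → RO Y} {a b : A} (hab : DeVriesAlgebra.prox a b) :
    roPreimage e (δ a) ⊆ star (roPreimage e) δ b :=
  le_sSup (a := roPreimage e (δ a)) ⟨a, hab, rfl⟩

/-- A de Vries morphism `δ : RO(Z) → RO(Y)` over `℘(X)` induces a continuous map `Y → Z` under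
`X`. -/
theorem compactificationLE_of_star_eq {X Y Z : Type*} [TopologicalSpace X]
    [TopologicalSpace Y] [CompactSpace Y] [T2Space Y] [TopologicalSpace Z] [CompactSpace Z]
    [T2Space Z] {e : X → Y} (he : IsDenseEmbedding e) {s : X → Z} (hs : Continuous s)
    {δ : RO Z → RO Y} (hδ : IsDeVriesMorphism δ)
    (h : star (roPreimage e) δ = roPreimage s) : CompactificationLE s e := by
  have hsub : ∀ {V W : RO Z}, closure V.toSet ⊆ W.toSet →
      e ⁻¹' (δ V).toSet ⊆ s ⁻¹' W.toSet := fun {V W} hVW => by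
    have := star_roPreimage_le (e := e) (δ := δ) (a := V) (b := W) hVW
    rwa [h] at this
  -- Take `V'' ≺ V' ≺ V ≺ W` with `z₁ ∈ V''` and `z₂ ∉ closure W`. As `V' ≺ V`, either `y ∈ δ V'ᶜ`,
  -- and `s` avoids `V''` near `y`, or `y ∈ δ V`, and `s` stays in `W` near `y`. The outer two links
  -- pay for the loss in `hsub`.
  have key : ∀ y z₁ z₂, MapClusterPt z₁ (comap e (𝓝 y)) s →
      MapClusterPt z₂ (comap e (𝓝 y)) s → z₁ = z₂ := by
    intro y z₁ z₂ h₁ h₂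
    by_contra hne
    obtain ⟨W, hW₁, hW₂⟩ := RO.exists_mem_closure_subset isOpen_compl_singleton
      (show z₁ ∈ ({z₂} : Set Z)ᶜ from hne)
    obtain ⟨V, hV₁, hVW⟩ := RO.exists_mem_closure_subset W.isOpen hW₁
    obtain ⟨V', hV'₁, hV'V⟩ := RO.exists_mem_closure_subset V.isOpen hV₁
    obtain ⟨V'', hV''₁, hV''V'⟩ := RO.exists_mem_closure_subset V'.isOpen hV'₁
    have hmem : ∀ {U : RO Y}, y ∈ U.toSet → e ⁻¹' U.toSet ∈ comap e (𝓝 y) := fun {U} hU =>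
      preimage_mem_comap (U.isOpen.mem_nhds hU)
    have hδVV' : closure ((δ V'ᶜ)ᶜ).toSet ⊆ (δ V).toSet := hδ.compl_map_compl_prox hV'V
    rw [RO.closure_compl_eq] at hδVV'
    by_cases hy : y ∈ (δ V'ᶜ).toSet
    · have hc : closure (V'ᶜ).toSet ⊆ (V''ᶜ).toSet :=
        DeVriesAlgebra.prox_compl (A := RO Z) (a := V'') (b := V') hV''V'
      obtain ⟨x, hx₁, hx₂⟩ := ((h₁.frequently (V''.isOpen.mem_nhds hV''₁)).and_eventually
        (mem_of_superset (hmem hy) (hsub hc))).exists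
      rw [RO.toSet_compl] at hx₂
      exact interior_subset hx₂ hx₁
    · obtain ⟨x, hx₁, hx₂⟩ := ((h₂.frequently (isClosed_closure.isOpen_compl.mem_nhds
        (fun hz => hW₂ hz rfl : z₂ ∈ (closure W.toSet)ᶜ))).and_eventually
        (mem_of_superset (hmem (hδVV' hy)) (hsub hVW))).exists
      exact hx₁ (subset_closure hx₂)
  -- In a compact space a unique cluster point is a limit.
  have hlim : ∀ y, ∃ z, Tendsto s (comap e (𝓝 y)) (𝓝 z) := by
    intro y
    have : (comap e (𝓝 y)).NeBot := he.toIsDenseInducing.comap_nhds_neBot y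
    obtain ⟨z, hz⟩ := exists_clusterPt_of_compactSpace (map s (comap e (𝓝 y)))
    exact ⟨z, le_nhds_of_unique_clusterPt fun w hw => key y w z hw hz⟩
  exact ⟨he.toIsDenseInducing.extend s, he.toIsDenseInducing.continuous_extend hlim,
    funext fun x => he.toIsDenseInducing.extend_eq hs x⟩

theorem stoneCech_le_of_isMaximalExtension {X Y : Type u} [TopologicalSpace X] [T35Space X]
    [TopologicalSpace Y] [CompactSpace Y] [T2Space Y] {e : X → Y} (he : IsDenseEmbedding e)
    (h : IsMaximalExtension (roPreimage e)) :
    CompactificationLE (stoneCechUnit : X → StoneCech X) e := by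
  have hs : IsDenseEmbedding (stoneCechUnit : X → StoneCech X) := isDenseEmbedding_stoneCechUnit
  obtain ⟨δ, hδ, hstar⟩ := h.exists_morphism _ _ (roPreimage_isDeVriesExtension hs)
    ((range_roPreimage he).trans (range_roPreimage hs).symm)
  exact compactificationLE_of_star_eq he hs.isInducing.continuous hδ hstar

theorem le_stoneCech {X Y : Type*} [TopologicalSpace X] [TopologicalSpace Y] [CompactSpace Y]
    [T2Space Y] {e : X → Y} (he : Continuous e) :
    CompactificationLE e (stoneCechUnit : X → StoneCech X) :=
  ⟨stoneCechExtend he, continuous_stoneCechExtend he, stoneCechExtend_extends he⟩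

/-! ## Isomorphism and equivalence of compactifications -/

namespace Compactification

/-- Both composites of the comparison maps fix a dense image pointwise, so they are identities. -/
theorem nonempty_iso_of_equiv {X Y Z : Type u} [TopologicalSpace X] [T35Space X]
    [TopologicalSpace Y] [CompactSpace Y] [T2Space Y] [TopologicalSpace Z] [CompactSpace Z]
    [T2Space Z] {e : X → Y} (he : IsDenseEmbedding e) {s : X → Z} (hs : IsDenseEmbedding s)
    (h : CompactificationEquiv e s) :
    Nonempty ((mk X Y e he : Compactification.{u}) ≅ mk X Z s hs) := by
  obtain ⟨⟨p, hp, hpe⟩, ⟨q, hq, hqs⟩⟩ := h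
  have hpx : ∀ x, p (s x) = e x := congrFun hpe
  have hqx : ∀ x, q (e x) = s x := congrFun hqs
  have hpq : p ∘ q = id := he.dense.equalizer (hp.comp hq) continuous_id
    (funext fun x => by simp [hpx, hqx])
  have hqp : q ∘ p = id := hs.dense.equalizer (hq.comp hp) continuous_id
    (funext fun x => by simp [hpx, hqx])
  exact ⟨{
    hom := Hom.mk (ContinuousMap.id X) ⟨q, hq⟩ hqx
    inv := Hom.mk (ContinuousMap.id X) ⟨p, hp⟩ hpx
    hom_inv_id := Hom.ext rfl (ContinuousMap.ext (congrFun hpq))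
    inv_hom_id := Hom.ext rfl (ContinuousMap.ext (congrFun hqp)) }⟩

/-- The isomorphism may move the points of `X`. The universal property of `βX` extends the inverse
base map, which undoes this. -/
theorem stoneCech_le_of_iso {X Y : Type u} [TopologicalSpace X] [T35Space X]
    [TopologicalSpace Y] [CompactSpace Y] [T2Space Y] {e : X → Y} (he : IsDenseEmbedding e)
    (i : (mk X Y e he : Compactification.{u}) ≅ stoneCech X) :
    CompactificationLE (stoneCechUnit : X → StoneCech X) e := by
  obtain ⟨φ, ψ, hφψ, -⟩ := i
  let f : X → X := φ.f
  let f' : X → X := ψ.f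
  let g : Y → StoneCech X := φ.g
  have hf : ∀ x, f' (f x) = x := fun x => DFunLike.congr_fun (congrArg Hom.f hφψ) x
  have hg : ∀ x, g (e x) = stoneCechUnit (f x) := φ.comm
  have hc : Continuous (stoneCechUnit ∘ f' : X → StoneCech X) :=
    continuous_stoneCechUnit.comp ψ.f.continuous
  refine ⟨stoneCechExtend hc ∘ g, (continuous_stoneCechExtend hc).comp φ.g.continuous,
    funext fun x => ?_⟩
  rw [Function.comp_apply, Function.comp_apply, hg, stoneCechExtend_stoneCechUnit,
    Function.comp_apply, hf]

end Compactification

end DeVries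

open DeVries CategoryTheory in
theorem theorem6p3 {X Y : Type u} [TopologicalSpace X] [T35Space X] [TopologicalSpace Y]
    [CompactSpace Y] [T2Space Y] (e : X → Y) (he : IsDenseEmbedding e) :
    IsDeVriesExtension (roPreimage e) ∧
    List.TFAE [
      IsMaximalExtension (roPreimage e),
      Nonempty ((Compactification.mk X Y e he : Compactification.{u}) ≅
        Compactification.stoneCech X),
      CompactificationEquiv e (stoneCechUnit : X → StoneCech X)] := by
  have hle := le_stoneCech he.isInducing.continuous
  refine ⟨roPreimage_isDeVriesExtension he, ?_⟩
  tfae_have 1 → 3 := fun h => ⟨hle, stoneCech_le_of_isMaximalExtension he h⟩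
  tfae_have 3 → 2 := fun h =>
    Compactification.nonempty_iso_of_equiv he isDenseEmbedding_stoneCechUnit h
  tfae_have 2 → 1 := fun ⟨i⟩ =>
    isMaximalExtension_of_stoneCech_le he (Compactification.stoneCech_le_of_iso he i)
  tfae_finish
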